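/- **Setting.** Let $\mathcal X$ be a finite set of variables. A *configuration* is either one of the symbols $\mathtt{SAT}$, $\mathtt{UNSAT}$ or a tuple $\langle \mathcal B,T,l,u,\alpha,R\rangle$, where $\mathcal B\subseteq\mathcal X$ is the set of basic variables, the tableau $T$ contains for each $x_i\in\mathcal B$ an equation $x_i=\sum_{x_j\notin\mathcal B}T_{i,j}x_j$ with real coefficients, $l(x)\in[-\infty,\infty]$ and $u(x)\in[-\infty,\infty]$ are the lower and upper bounds of $x$, $\alpha:\mathcal X\to\mathbb R$ is the assignment, and $R\subseteq\mathcal X\times\mathcal X$ is the set of ReLU pairs. A tuple is *well-formed* if $\alpha$ satisfies all equations of $T$ and every interval $[l(x),u(x)]$ contains a real number; this holds for the initial configuration of every conjunction of linear atoms $\sum_i c_ix_i\bowtie d$ ($\bowtie\,\in\{=,\le,\ge\}$) and atoms $\mathrm{ReLU}(x,y)$. A pair $\langle x_b,x_f\rangle\in R$ is *broken* if $\alpha(x_f)\ne\max(0,\alpha(x_b))$. For $x_i\in\mathcal B$, $x_j\notin\mathcal B$, $T_{i,j}\neq0$, $\mathrm{pivot}(i,j)$ solves the equation of $x_i$ for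 $x_j$, substitutes the result in the other equations, and replaces $x_i$ by $x_j$ in $\mathcal B$. For $x_j\notin\mathcal B$, $\mathrm{update}(x_j,\delta)$ adds $\delta$ to $\alpha(x_j)$ and $\delta T_{i,j}$ to $\alpha(x_i)$ for each $x_i\in\mathcal B$. Let $\mathrm{slack}^{+}(x_i)$ be the set of $x_j\notin\mathcal B$ with ($T_{i,j}>0$ and $\alpha(x_j)<u(x_j)$) or ($T_{i,j}<0$ and $\alpha(x_j)>l(x_j)$), and $\mathrm{slack}^-(x_i)$ the set defined in the same way with the two signs of $T_{i,j}$ exchanged. The rules are: * *Simplex rules.* $\mathsf{Pivot}_1$: if $x_i\in\mathcal B$, $\alpha(x_i)<l(x_i)$ and $x_j\in\mathrm{slack}^+(x_i)$, then $\mathrm{pivot}(i,j)$. $\mathsf{Pivot}_2$: if $x_i\in\mathcal B$, $\alpha(x_i)>u(x_i)$ and $x_j\in\mathrm{slack}^-(x_i)$, then $\mathrm{pivot}(i,j)$. $\mathsf{Update}$: if $x_j\notin\mathcal B$ is out of bounds and $l(x_j)\le\alpha(x_j)+\delta\le u(x_j)$, then $\mathrm{update}(x_j,\delta)$. $\mathsf{Failure}$: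 if some $x_i\in\mathcal B$ has $\alpha(x_i)<l(x_i)$ and $\mathrm{slack}^+(x_i)=\emptyset$, or $\alpha(x_i)>u(x_i)$ and $\mathrm{slack}^-(x_i)=\emptyset$, then $\mathtt{UNSAT}$. * *ReLU rules*, for a pair $\langle x_b,x_f\rangle\in R$. $\mathsf{Update}_b$: if the pair is broken, $x_b\notin\mathcal B$ and $\alpha(x_f)\ge0$, then $\mathrm{update}(x_b,\alpha(x_f)-\alpha(x_b))$. $\mathsf{Update}_f$: if the pair is broken and $x_f\notin\mathcal B$, then $\mathrm{update}(x_f,\max(0,\alpha(x_b))-\alpha(x_f))$. $\mathsf{PivotForRelu}$: if $x_i\in\mathcal B$ is one of $x_b,x_f$, and $x_j\notin\mathcal B$, $T_{i,j}\ne0$, then $\mathrm{pivot}(i,j)$. * $\mathsf{ReluSplit}$: if $\langle x_b,x_f\rangle\in R$ and $l(x_b)<0<u(x_b)$, create two children, one with $u(x_b):=0$ and one with $l(x_b):=0$. * $\mathsf{ReluSuccess}$: if all variables are within their bounds and no pair of $R$ is broken, then $\mathtt{SAT}$. A *derivation tree* is a tree of configurations in which the children of a node result from applying a rule to it. A *derivation*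 is a sequence of derivation trees that starts with a single node and in which each tree results from the preceding one by applying one rule to one leaf. A *simplex strategy* selects, depending on the current configuration and on those visited since the strategy was last started, a set of permitted applications of the simplex rules. It is *terminating* if, from every well-formed starting configuration, it has no infinite run, and at every configuration reached in which some variable is out of bounds it permits a move. Thus, after finitely many steps, all variables are within their bounds or $\mathsf{Failure}$ has been applied. **The strategy.** Fix a terminating simplex strategy $\sigma$ and $K\in\mathbb N$. Every node has, for each pair of $R$, a counter, which is $0$ at the root. * Out-of-bounds violations are fixed with $\sigma$, which is started anew after every ReLU rule and every split. * If all variables are within their bounds, $\mathsf{ReluSuccess}$ may be applied if no pair is broken, and one of $\mathsf{Update}_b$, $\mathsf{Update}_f$, $\mathsf{PivotForRelu}$ may be applied to a broken pair with counter at most $K$. This increases the counter of the pair by $1$. * $\mathsf{ReluSplit}$ may be applied to a pair exactly when its counter exceeds $K$ (and the guard of $\mathsf{ReluSplit}$ holds). The counter of the pair may be kept or restarted at $0$ in the children. All remaining choices are arbitrary. **Theorem.** Terminating simplex strategies exist. For every terminating simplex strategy $\sigma$, every $K\in\mathbb N$ and every well-formed configuration $c$, the strategy started in $c$ terminates: there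 is no infinite derivation from $c$ that follows it. Moreover, if a derivation from $c$ that follows the strategy ends in a tree that the strategy cannot extend, then each leaf of this tree is $\mathtt{SAT}$, or $\mathtt{UNSAT}$, or a configuration with all variables within their bounds, with at least one broken pair, and such that every broken pair $\langle x_b,x_f\rangle$ has a counter exceeding $K$ and satisfies $l(x_b)\ge0$ or $u(x_b)\le0$, so that it cannot be split. -/

import Mathlib

open Finset

namespace Reluplex

/-- A (non-distinguished) Reluplex configuration over the variables `X`: the set of basic variables,
the tableau (row `i`, `i ∈ B`, is the equation `x_i = ∑_{j ∉ B} T i j * x_j`), the lower and upper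
bounds (possibly infinite), the current assignment and the set of ReLU connections
(`(b, f) ∈ R` stands for the atom `x_f = max (0, x_b)`). -/
structure Config (X : Type*) where
  B : Finset X
  T : X → X → ℝ
  l : X → EReal
  u : X → EReal
  α : X → ℝ
  R : Finset (X × X)

/-- A configuration or one of the distinguished symbols `SAT`, `UNSAT`. -/
inductive State (X : Type*) where
  | sat : State X
  | unsat : State X
  | run (c : Config X) : State X

namespace Config

variable {X : Type*}

/-- The variable `x` is below its lower bound. -/
def Below (c : Config X) (x : X) : Prop := (c.α x : EReal) < c.l x

/-- The variable `x` is above its upper bound. -/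
def Above (c : Config X) (x : X) : Prop := c.u x < (c.α x : EReal)

/-- All variables are within their bounds. -/
def InBounds (c : Config X) : Prop := ∀ x, c.l x ≤ (c.α x : EReal) ∧ (c.α x : EReal) ≤ c.u x

/-- The pair `p = (b, f)` violates the ReLU semantics. -/
def Broken (c : Config X) (p : X × X) : Prop := c.α p.2 ≠ max 0 (c.α p.1)

/-- `slack⁺(x_i)`: the non-basic variables that can be moved so as to increase `x_i`. -/
def slackPos (c : Config X) (i : X) : Set X :=
  {j | j ∉ c.B ∧ ((0 < c.T i j ∧ (c.α j : EReal) < c.u j) ∨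
    (c.T i j < 0 ∧ c.l j < (c.α j : EReal)))}

/-- `slack⁻(x_i)`: the non-basic variables that can be moved so as to decrease `x_i`. -/
def slackNeg (c : Config X) (i : X) : Set X :=
  {j | j ∉ c.B ∧ ((c.T i j < 0 ∧ (c.α j : EReal) < c.u j) ∨
    (0 < c.T i j ∧ c.l j < (c.α j : EReal)))}

/-- The standing conventions on configurations: the matrix `T` has entries only in basic rows and
non-basic columns, the assignment satisfies the tableau equations, and no variable has
contradictory bounds (some real number lies between them). -/
structure WellFormed [Fintype X] [DecidableEq X] (c : Config X) : Prop where
  support : ∀ i j, c.T i j ≠ 0 → i ∈ c.B ∧ j ∉ c.B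
  satisfies : ∀ i ∈ c.B, c.α i = ∑ j ∈ c.Bᶜ, c.T i j * c.α j
  bounds : ∀ x, ∃ v : ℝ, c.l x ≤ (v : EReal) ∧ (v : EReal) ≤ c.u x

variable [DecidableEq X]

/-- Pivoting the basic variable `x_i` with the non-basic variable `x_j` (used when `T i j ≠ 0`):
the row of `x_i` is solved for `x_j`, and `x_j` is eliminated from all other rows. -/
noncomputable def pivot (c : Config X) (i j : X) : Config X :=
  { c with
    B := (insert j c.B).erase i
    T := fun r k =>
      if r = i then 0
      else if r = j then
        (if k = i then 1 / c.T i j else if k = j then 0 else -(c.T i k / c.T i j))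
      else
        (if k = i then c.T r j / c.T i j else if k = j then 0
          else c.T r k - c.T r j * (c.T i k / c.T i j)) }

/-- `update (α, x_j, δ)` for a non-basic variable `x_j`. -/
noncomputable def update (c : Config X) (j : X) (δ : ℝ) : Config X :=
  { c with
    α := fun k => if k = j then c.α j + δ else if k ∈ c.B then c.α k + δ * c.T k j else c.α k }

end Config

open Config

/-- The rules `Pivot₁`, `Pivot₂`, `Update` and `Failure` of the simplex calculus. -/
inductive SimplexRule {X : Type*} [DecidableEq X] : Config X → State X → Prop
  | pivot₁ (c : Config X) (i j : X) : i ∈ c.B → c.Below i → j ∈ c.slackPos i →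
      SimplexRule c (.run (c.pivot i j))
  | pivot₂ (c : Config X) (i j : X) : i ∈ c.B → c.Above i → j ∈ c.slackNeg i →
      SimplexRule c (.run (c.pivot i j))
  | update (c : Config X) (j : X) (δ : ℝ) : j ∉ c.B → (c.Below j ∨ c.Above j) →
      c.l j ≤ ((c.α j + δ : ℝ) : EReal) → ((c.α j + δ : ℝ) : EReal) ≤ c.u j →
      SimplexRule c (.run (c.update j δ))
  | failure (c : Config X) (i : X) : i ∈ c.B →
      ((c.Below i ∧ c.slackPos i = ∅) ∨ (c.Above i ∧ c.slackNeg i = ∅)) →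
      SimplexRule c .unsat

/-- The rules `Update_b`, `Update_f` and `PivotForRelu`, applied to the ReLU pair `p`. -/
inductive ReluRule {X : Type*} [DecidableEq X] (p : X × X) : Config X → Config X → Prop
  | updateB (c : Config X) : p ∈ c.R → p.1 ∉ c.B → c.Broken p → 0 ≤ c.α p.2 →
      ReluRule p c (c.update p.1 (c.α p.2 - c.α p.1))
  | updateF (c : Config X) : p ∈ c.R → p.2 ∉ c.B → c.Broken p →
      ReluRule p c (c.update p.2 (max 0 (c.α p.1) - c.α p.2))
  | pivotForRelu (c : Config X) (i j : X) : p ∈ c.R → (i = p.1 ∨ i = p.2) → i ∈ c.B → j ∉ c.B →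
      c.T i j ≠ 0 → ReluRule p c (c.pivot i j)

/-- The rule `ReluSplit`, applied to the ReLU pair `p`: the first child is the inactive case, the
second child is the active case. -/
inductive SplitRule {X : Type*} [DecidableEq X] (p : X × X) :
    Config X → Config X → Config X → Prop
  | split (c : Config X) : p ∈ c.R → c.l p.1 < 0 → 0 < c.u p.1 →
      SplitRule p c { c with u := Function.update c.u p.1 0 }
        { c with l := Function.update c.l p.1 0 }

/-- The rule `ReluSuccess` applies. -/
def ReluSuccess {X : Type*} (c : Config X) : Prop := c.InBounds ∧ ∀ p ∈ c.R, ¬ c.Broken p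

/-- A strategy for applying the simplex rules. It may be nondeterministic and may depend on the
history: `next h c s` says that the strategy allows passing from `c` to `s` when `h` is the list of
the configurations that it visited before `c` (since it was last started). -/
structure SimplexStrategy (X : Type*) [DecidableEq X] where
  next : List (Config X) → Config X → State X → Prop
  isRule : ∀ h c s, next h c s → SimplexRule c s

/-- The first `n` steps of `f` are made by the strategy, started in the configuration `f 0`. -/
def SimplexStrategy.IsRun {X : Type*} [Fintype X] [DecidableEq X] (σ : SimplexStrategy X)
    (f : ℕ → Config X) (n : ℕ) : Prop :=
  (f 0).WellFormed ∧ ∀ m < n, σ.next ((List.range m).map f) (f m) (.run (f (m + 1)))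

/-- Wherever it is started, the strategy reaches, in finitely many steps, a configuration with all
variables within their bounds or applies `Failure`: it always has a move as long as some variable
is out of bounds, and it does not admit infinite runs. -/
structure SimplexStrategy.Terminating {X : Type*} [Fintype X] [DecidableEq X]
    (σ : SimplexStrategy X) : Prop where
  progress : ∀ f n, σ.IsRun f n → ¬ (f n).InBounds → ∃ s, σ.next ((List.range n).map f) (f n) s
  finite : ¬ ∃ f, ∀ n, σ.IsRun f n

/-- The nodes of derivation trees. A configuration comes with the bookkeeping of the strategy:
`count p` is the number of applications of the three ReLU rules to the pair `p` on the branch so far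
(or since a split of `p` at which the count was restarted), and `hist` holds the configurations visited by the simplex strategy since it was last started. -/
inductive Node (X : Type*) where
  | sat : Node X
  | unsat : Node X
  | run (c : Config X) (count : X × X → ℕ) (hist : List (Config X)) : Node X

/-- The strategy, rules with one conclusion. Out-of-bounds violations are handled by `σ`. Only
when all variables are within their bounds, a violated ReLU pair may be corrected by `Update_b`,
`Update_f` or `PivotForRelu`, and only if these rules have not already been applied to it more than
`K` times. -/
inductive Step {X : Type*} [DecidableEq X] (σ : SimplexStrategy X) (K : ℕ) :
    Node X → Node X → Prop
  | simplex (c c' : Config X) (count : X × X → ℕ) (hist : List (Config X)) :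
      σ.next hist c (.run c') → Step σ K (.run c count hist) (.run c' count (hist ++ [c]))
  | failure (c : Config X) (count : X × X → ℕ) (hist : List (Config X)) :
      σ.next hist c .unsat → Step σ K (.run c count hist) .unsat
  | success (c : Config X) (count : X × X → ℕ) (hist : List (Config X)) :
      ReluSuccess c → Step σ K (.run c count hist) .sat
  | relu (c c' : Config X) (count : X × X → ℕ) (hist : List (Config X)) (p : X × X) :
      c.InBounds → c.Broken p → count p ≤ K → ReluRule p c c' →
      Step σ K (.run c count hist) (.run c' (Function.update count p (count p + 1)) [])

/-- The strategy, splitting. A ReLU pair is split once the three ReLU rules have been applied to it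
more than `K` times. The count of this pair may be kept or restarted in the two children. -/
inductive Split {X : Type*} [DecidableEq X] (K : ℕ) : Node X → Node X → Node X → Prop
  | split (c c₁ c₂ : Config X) (count count' : X × X → ℕ) (hist : List (Config X)) (p : X × X) :
      K < count p → SplitRule p c c₁ c₂ →
      (count' = count ∨ count' = Function.update count p 0) →
      Split K (.run c count hist) (.run c₁ count' []) (.run c₂ count' [])

/-- Derivation trees. A node has no child, one child, or (after a split) two children. -/
inductive Tree (X : Type*) where
  | leaf (s : Node X) : Tree X
  | one (s : Node X) (t : Tree X) : Tree X
  | two (s : Node X) (t₁ t₂ : Tree X) : Tree X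

/-- The set of leaves of a derivation tree. -/
def Tree.leaves {X : Type*} : Tree X → Set (Node X)
  | .leaf s => {s}
  | .one _ t => t.leaves
  | .two _ t₁ t₂ => t₁.leaves ∪ t₂.leaves

/-- `Derives σ K D D'`: the tree `D'` is obtained from `D` by applying exactly one rule, as allowed
by the strategy, to one leaf of `D`. -/
inductive Derives {X : Type*} [DecidableEq X] (σ : SimplexStrategy X) (K : ℕ) :
    Tree X → Tree X → Prop
  | step (s s' : Node X) : Step σ K s s' → Derives σ K (.leaf s) (.one s (.leaf s'))
  | split (s s₁ s₂ : Node X) : Split K s s₁ s₂ →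
      Derives σ K (.leaf s) (.two s (.leaf s₁) (.leaf s₂))
  | one (s : Node X) (t t' : Tree X) : Derives σ K t t' → Derives σ K (.one s t) (.one s t')
  | left (s : Node X) (t₁ t₁' t₂ : Tree X) : Derives σ K t₁ t₁' →
      Derives σ K (.two s t₁ t₂) (.two s t₁' t₂)
  | right (s : Node X) (t₁ t₂ t₂' : Tree X) : Derives σ K t₂ t₂' →
      Derives σ K (.two s t₁ t₂) (.two s t₁ t₂')

/-- The one-node tree in which the strategy is started. -/
def startTree {X : Type*} (c : Config X) : Tree X := .leaf (.run c (fun _ => 0) [])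

/-- The nodes in which the strategy may halt: `SAT`, `UNSAT`, or a configuration with all variables
within their bounds in which every violated ReLU pair (there is one) has used up its `K + 1` rule
applications and cannot be split, the sign of its backward-facing variable being fixed by the
bounds. -/
def Node.Halting {X : Type*} (K : ℕ) : Node X → Prop
  | .sat => True
  | .unsat => True
  | .run c count _ => c.InBounds ∧ (∃ p ∈ c.R, c.Broken p) ∧
      ∀ p ∈ c.R, c.Broken p → K < count p ∧ (0 ≤ c.l p.1 ∨ c.u p.1 ≤ 0)

/-- The relation symbol of a linear atom. -/
inductive Cmp where
  | eq : Cmp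
  | le : Cmp
  | ge : Cmp

/-- The linear atom `∑ x, coeff x * x ⋈ d`. -/
structure LinearAtom (V : Type*) where
  coeff : V → ℝ
  cmp : Cmp
  d : ℝ

/-- The initial configuration of the conjunction of the linear atoms `A k` and of the atoms
`ReLU (x, y)`, `(x, y) ∈ P`: a fresh basic variable `Sum.inr k` is introduced for each linear
atom, and all variables are assigned `0`. -/
noncomputable def initial {V : Type*} [Fintype V] [DecidableEq V] {m : ℕ} (A : Fin m → LinearAtom V)
    (P : Finset (V × V)) : Config (V ⊕ Fin m) where
  B := univ.image Sum.inr
  T := fun i j => match i, j with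
    | .inr k, .inl v => (A k).coeff v
    | _, _ => 0
  l := fun x => match x with
    | .inl _ => ⊥
    | .inr k => match (A k).cmp with
      | .le => ⊥
      | _ => ((A k).d : EReal)
  u := fun x => match x with
    | .inl _ => ⊤
    | .inr k => match (A k).cmp with
      | .ge => ⊤
      | _ => ((A k).d : EReal)
  α := fun _ => 0
  R := P.image (fun p => (Sum.inl p.1, Sum.inl p.2))

/-- Initial configurations are well-formed. -/
theorem initial_wellFormed {V : Type*} [Fintype V] [DecidableEq V] {m : ℕ}
    (A : Fin m → LinearAtom V) (P : Finset (V × V)) : (initial A P).WellFormed where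
  support := by
    rintro (i | i) (j | j) h <;> simp_all [initial]
  satisfies := by
    intro i _
    simp [initial]
  bounds := by
    rintro (v | k)
    · exact ⟨0, by simp [initial], by simp [initial]⟩
    · refine ⟨(A k).d, ?_⟩
      cases h : (A k).cmp <;> simp [initial, h]

end Reluplex

/-!
Existence of terminating simplex strategies. It suffices that from every well-formed configuration
some finite sequence of simplex moves leads to a configuration with all variables within their
bounds or with `Failure` applicable (`WellFormed.exists_decided`): the strategy `descent` then
permits `Failure` and exactly those other moves that lower the distance to such a configuration.
To find the sequence, first update the non-basic variables into their bounds, then solve the problem restricted to larger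
and larger sets `S` of variables (`solvable`). The variables outside `S` are frozen while they are
non-basic and free while they are basic. Suppose that the problem for `S` can be solved and add
`x_n`. Solve for `S` first. If this ends with a variable blocked in `S` that `x_n` can repair, let
`x_n` enter the basis and solve for `S` again. If it ends with `x_n` basic and out of bounds, let
`x_n` leave the basis, set it to the bound it violates, and solve for `S` again. After that `x_n`
cannot enter the basis once more. Otherwise the row of the blocked variable, evaluated at the
current assignment and at the one before `x_n` left, where `S` is within its bounds and `x_n`
violates the bound, shows that the blocked variable was out of bounds then as well
(`Blocked.insert`). So at most two exchanges involving `x_n` are needed.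

Termination. On a branch, a split lowers the number of pairs whose backward-facing variable has
bounds of strictly opposite signs, and no other rule changes this number. Each application of a ReLU
rule lowers the number of applications that the counters still permit. Between these rules only
simplex moves are made, and an infinite sequence of them would be an infinite run of the given
strategy. So the child relation on nodes is well-founded below every start node (`acc_child`). The
same holds for the extension of trees by structural recursion (`acc_leaf`, `acc_one`, `acc_two`),
which makes an appeal to König's lemma unnecessary.

Leaves of maximal trees. A leaf that is out of bounds still has a simplex move, because its history
is that of a run of the given strategy (`Node.Legal`). To a leaf within its bounds `ReluSuccess`
applies, unless a pair is broken, and some ReLU rule applies to every broken pair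
(`exists_reluRule`). So all counters of broken pairs exceed `K`, and the guard of `ReluSplit` fails.
-/

namespace Reluplex

/-! ### Solutions of the tableau and preservation of well-formedness -/

namespace Config

variable {X : Type*} [Fintype X]

/-- The assignment `a` solves the tableau equations of `c`. The sum ranges over all variables: the
columns of basic variables vanish in a well-formed configuration. -/
def Solves (c : Config X) (a : X → ℝ) : Prop := ∀ i ∈ c.B, a i = ∑ j, c.T i j * a j

/-- The value of `x` lies within its bounds. -/
def Within (c : Config X) (x : X) : Prop := c.l x ≤ (c.α x : EReal) ∧ (c.α x : EReal) ≤ c.u x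

theorem within_or {X : Type*} (c : Config X) (x : X) : c.Within x ∨ c.Below x ∨ c.Above x := by
  unfold Within Below Above
  rcases lt_or_ge (c.α x : EReal) (c.l x) with h | h
  · exact .inr (.inl h)
  rcases lt_or_ge (c.u x) (c.α x : EReal) with h' | h'
  · exact .inr (.inr h')
  · exact .inl ⟨h, h'⟩

variable [DecidableEq X]

theorem sum_compl_eq {c : Config X} (hs : ∀ i j, c.T i j ≠ 0 → i ∈ c.B ∧ j ∉ c.B) (i : X)
    (a : X → ℝ) : ∑ j ∈ c.Bᶜ, c.T i j * a j = ∑ j, c.T i j * a j := by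
  refine Finset.sum_subset (Finset.subset_univ _) fun j _ hj => ?_
  by_contra h
  exact hj (by simpa using (hs i j (left_ne_zero_of_mul h)).2)

namespace WellFormed

variable {c : Config X}

theorem solves (h : c.WellFormed) : c.Solves c.α := fun i hi => by
  rw [h.satisfies i hi, sum_compl_eq h.support]

theorem of_solves (hs : ∀ i j, c.T i j ≠ 0 → i ∈ c.B ∧ j ∉ c.B) (ha : c.Solves c.α)
    (hb : ∀ x, ∃ v : ℝ, c.l x ≤ (v : EReal) ∧ (v : EReal) ≤ c.u x) : c.WellFormed :=
  ⟨hs, fun i hi => by rw [sum_compl_eq hs, ← ha i hi], hb⟩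

theorem eq_zero_of_mem (h : c.WellFormed) {j : X} (hj : j ∈ c.B) (i : X) : c.T i j = 0 := by
  by_contra h'
  exact (h.support i j h').2 hj

/-- Pivoting turns the tableau into consequences of its equations. -/
theorem solves_pivot (h : c.WellFormed) {i j : X} (hi : i ∈ c.B) (hT : c.T i j ≠ 0)
    {a : X → ℝ} (ha : c.Solves a) : (c.pivot i j).Solves a := by
  have hj : j ∉ c.B := (h.support i j hT).2
  have hji : j ≠ i := fun e => hj (e ▸ hi)
  intro r hr
  obtain ⟨hri, hr⟩ : r ≠ i ∧ (r = j ∨ r ∈ c.B) := by simpa [pivot] using hr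
  by_cases hrj : r = j
  · subst hrj
    have e : ∀ k, (c.pivot i r).T r k * a k = -(c.T i r)⁻¹ * (c.T i k * a k)
        + (if k = i then (c.T i r)⁻¹ * a k else 0) + (if k = r then a k else 0) := by
      intro k
      by_cases h1 : k = i
      · subst h1
        simp [pivot, hji, hji.symm, h.eq_zero_of_mem hi]
      · by_cases h2 : k = r
        · subst h2
          simp [pivot, h1]
          field_simp
          ring
        · simp [pivot, hji, h1, h2]
          ring
    rw [Finset.sum_congr rfl fun k _ => e k, Finset.sum_add_distrib, Finset.sum_add_distrib,
      ← Finset.mul_sum, ← ha i hi]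
    simp
  · have hrB : r ∈ c.B := hr.resolve_left hrj
    have e : ∀ k, (c.pivot i j).T r k * a k = c.T r k * a k
        - c.T r j * (c.T i j)⁻¹ * (c.T i k * a k)
        + (if k = i then c.T r j * (c.T i j)⁻¹ * a k else 0) := by
      intro k
      by_cases h1 : k = i
      · subst h1
        simp [pivot, hri, hrj, h.eq_zero_of_mem hi, div_eq_mul_inv]
      · by_cases h2 : k = j
        · subst h2
          simp [pivot, hri, hrj, h1]
          field_simp
          ring
        · simp [pivot, hri, hrj, h1, h2]
          ring
    rw [Finset.sum_congr rfl fun k _ => e k, Finset.sum_add_distrib, Finset.sum_sub_distrib,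
      ← Finset.mul_sum, ← ha i hi, ← ha r hrB]
    simp

theorem pivot (h : c.WellFormed) {i j : X} (hi : i ∈ c.B) (hT : c.T i j ≠ 0) :
    (c.pivot i j).WellFormed := by
  refine of_solves ?_ (h.solves_pivot hi hT h.solves) h.bounds
  have hj : j ∉ c.B := (h.support i j hT).2
  have hji : j ≠ i := fun e => hj (e ▸ hi)
  intro r k hrk
  have hrk' := h.support r k
  have hrj' := h.support r j
  have hik' := h.support i k
  simp only [Config.pivot] at hrk
  simp only [Config.pivot, Finset.mem_erase, Finset.mem_insert]
  split_ifs at hrk <;> grind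

theorem update (h : c.WellFormed) {j : X} (hj : j ∉ c.B) (δ : ℝ) :
    (c.update j δ).WellFormed := by
  refine of_solves h.support (fun i hi => ?_) h.bounds
  have hi' : i ∈ c.B := hi
  have hij : i ≠ j := fun e => hj (e ▸ hi')
  have e : ∀ k, (c.update j δ).T i k * (c.update j δ).α k
      = c.T i k * c.α k + (if k = j then δ * c.T i k else 0) := by
    intro k
    by_cases h1 : k = j
    · simp [Config.update, h1]
      ring
    · by_cases h2 : k ∈ c.B
      · simp [Config.update, h1, h2, h.eq_zero_of_mem h2]
      · simp [Config.update, h1, h2]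
  rw [Finset.sum_congr rfl fun k _ => e k, Finset.sum_add_distrib, ← h.solves i hi']
  simp [Config.update, hij, hi']

theorem simplexRule (h : c.WellFormed) {c' : Config X} (hr : SimplexRule c (.run c')) :
    c'.WellFormed := by
  cases hr with
  | pivot₁ i j hi _ hj => exact h.pivot hi (hj.2.elim (fun h => h.1.ne') fun h => h.1.ne)
  | pivot₂ i j hi _ hj => exact h.pivot hi (hj.2.elim (fun h => h.1.ne) fun h => h.1.ne')
  | update j δ hj => exact h.update hj δ

theorem reluRule (h : c.WellFormed) {c' : Config X} {p : X × X} (hr : ReluRule p c c') :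
    c'.WellFormed := by
  cases hr with
  | updateB _ hj => exact h.update hj _
  | updateF _ hj => exact h.update hj _
  | pivotForRelu i j _ _ hi _ hT => exact h.pivot hi hT

theorem splitRule (h : c.WellFormed) {c₁ c₂ : Config X} {p : X × X} (hr : SplitRule p c c₁ c₂) :
    c₁.WellFormed ∧ c₂.WellFormed := by
  cases hr with
  | split _ hl hu =>
    refine ⟨⟨h.support, h.satisfies, fun x => ?_⟩, ⟨h.support, h.satisfies, fun x => ?_⟩⟩ <;>
    · by_cases hx : x = p.1
      · subst hx
        exact ⟨0, by simp [hl.le, hu.le]⟩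
      · simpa [hx] using h.bounds x

end WellFormed

end Config

open Config

theorem SimplexRule.frame {X : Type*} [DecidableEq X] {c c' : Config X}
    (h : SimplexRule c (.run c')) :
    c'.l = c.l ∧ c'.u = c.u ∧ c'.R = c.R := by
  cases h <;> exact ⟨rfl, rfl, rfl⟩

theorem ReluRule.frame {X : Type*} [DecidableEq X] {c c' : Config X} {p : X × X}
    (h : ReluRule p c c') :
    c'.l = c.l ∧ c'.u = c.u ∧ c'.R = c.R := by
  cases h <;> exact ⟨rfl, rfl, rfl⟩

/-! ### Reaching a decided configuration by simplex moves -/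

namespace Config

/-- One move of the simplex calculus that does not end in `UNSAT`. -/
def Next {X : Type*} [DecidableEq X] (c c' : Config X) : Prop := SimplexRule c (.run c')

variable {X : Type*} [Fintype X] [DecidableEq X]

/-- A well-formed configuration whose non-basic variables are all within their bounds. -/
def Ready (c : Config X) : Prop := c.WellFormed ∧ ∀ x ∉ c.B, c.Within x

/-- `c'` is reached from `c` by simplex moves that exchange and update variables of `S` only. The
variables outside `S` keep their status, those that are non-basic keep their value, and every
solution of the old tableau solves the new one. -/
structure Reach (S : Finset X) (c c' : Config X) : Prop where
  path : Relation.ReflTransGen Next c c'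
  l_eq : c'.l = c.l
  u_eq : c'.u = c.u
  solves : ∀ a, c.Solves a → c'.Solves a
  basic : ∀ x ∉ S, (x ∈ c'.B ↔ x ∈ c.B)
  frozen : ∀ x ∉ S, x ∉ c.B → c'.α x = c.α x

theorem Reach.trans {S : Finset X} {c c' c'' : Config X} (h : Reach S c c') (h' : Reach S c' c'') :
    Reach S c c'' where
  path := h.path.trans h'.path
  l_eq := h'.l_eq.trans h.l_eq
  u_eq := h'.u_eq.trans h.u_eq
  solves a ha := h'.solves a (h.solves a ha)
  basic x hx := (h'.basic x hx).trans (h.basic x hx)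
  frozen x hx hB := (h'.frozen x hx (mt (h.basic x hx).1 hB)).trans (h.frozen x hx hB)

theorem Reach.mono {S S' : Finset X} (hS : S ⊆ S') {c c' : Config X} (h : Reach S c c') :
    Reach S' c c' :=
  { h with
    basic := fun x hx => h.basic x (mt (@hS x) hx)
    frozen := fun x hx => h.frozen x (mt (@hS x) hx) }

theorem Reach.refl (S : Finset X) (c : Config X) : Reach S c c :=
  ⟨.refl, rfl, rfl, fun _ h => h, fun _ _ => Iff.rfl, fun _ _ _ => rfl⟩

/-- The variable `x_i` is out of bounds, and no variable of `S` has slack to repair it. -/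
def Blocked (c : Config X) (S : Finset X) (i : X) : Prop :=
  (c.Below i ∧ ∀ j ∈ S, j ∉ c.slackPos i) ∨ (c.Above i ∧ ∀ j ∈ S, j ∉ c.slackNeg i)

/-- The restriction of the problem to the variables of `S` is decided: they are all within their
bounds, or one of them is basic and blocked. -/
def Settled (c : Config X) (S : Finset X) : Prop :=
  (∀ x ∈ S, c.Within x) ∨ ∃ i ∈ S, i ∈ c.B ∧ c.Blocked S i

theorem WellFormed.exists_coe_eq_l {c : Config X} (h : c.WellFormed) {x : X} (hx : c.Below x) :
    ∃ v : ℝ, (v : EReal) = c.l x := by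
  obtain ⟨w, hw, -⟩ := h.bounds x
  exact ⟨(c.l x).toReal, EReal.coe_toReal (hw.trans_lt (EReal.coe_lt_top w)).ne
    ((EReal.bot_lt_coe _).trans hx).ne'⟩

theorem WellFormed.exists_coe_eq_u {c : Config X} (h : c.WellFormed) {x : X} (hx : c.Above x) :
    ∃ v : ℝ, (v : EReal) = c.u x := by
  obtain ⟨w, -, hw⟩ := h.bounds x
  exact ⟨(c.u x).toReal, EReal.coe_toReal (hx.trans (EReal.coe_lt_top _)).ne
    ((EReal.bot_lt_coe w).trans_le hw).ne'⟩

/-- A pivot followed by an update: the violated basic variable `x_i` is exchanged with `x_j` and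
then set to any value within its bounds. -/
theorem Ready.exchange {c : Config X} (h : c.Ready) {S : Finset X} {i j : X} (hi : i ∈ c.B)
    (hiS : i ∈ S) (hjS : j ∈ S)
    (hr : (c.Below i ∧ j ∈ c.slackPos i) ∨ (c.Above i ∧ j ∈ c.slackNeg i)) {v : ℝ}
    (hl : c.l i ≤ (v : EReal)) (hu : (v : EReal) ≤ c.u i) :
    ∃ c' : Config X, c'.Ready ∧ Reach S c c' ∧ c'.B = (insert j c.B).erase i ∧ c'.α i = v := by
  have hj : j ∉ c.B := hr.elim (fun h => h.2.1) fun h => h.2.1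
  have hstep : Next c (c.pivot i j) := hr.elim (fun h => .pivot₁ c i j hi h.1 h.2)
    fun h => .pivot₂ c i j hi h.1 h.2
  have hT : c.T i j ≠ 0 := by
    rcases hr with ⟨-, -, h | h⟩ | ⟨-, -, h | h⟩
    exacts [h.1.ne', h.1.ne, h.1.ne, h.1.ne']
  have hiB : i ∉ (c.pivot i j).B := Finset.notMem_erase _ _
  have hv : (c.pivot i j).α i + (v - c.α i) = v := by simp [pivot]
  have hα : ∀ x ≠ i, x ∉ (c.pivot i j).B → ((c.pivot i j).update i (v - c.α i)).α x = c.α x := by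
    intro x hx hxB
    simp only [update, hx, hxB, if_false]
    rfl
  have hαi : ((c.pivot i j).update i (v - c.α i)).α i = v := by simp [update, hv]
  refine ⟨(c.pivot i j).update i (v - c.α i), ⟨(h.1.pivot hi hT).update hiB _, fun x hx => ?_⟩,
    ⟨?_, rfl, rfl, fun a ha => h.1.solves_pivot hi hT ha, fun x hx => ?_, fun x hx hxB => ?_⟩,
    rfl, hαi⟩
  · unfold Within
    by_cases hxi : x = i
    · subst hxi
      rw [hαi]
      exact ⟨hl, hu⟩
    · rw [hα x hxi hx]
      refine h.2 x fun hxB => hx ?_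
      exact Finset.mem_erase.2 ⟨hxi, Finset.mem_insert_of_mem hxB⟩
  · refine (Relation.ReflTransGen.single hstep).tail (SimplexRule.update _ i _ hiB ?_ ?_ ?_)
    · exact hr.imp (fun h => h.1) fun h => h.1
    · rwa [hv]
    · rwa [hv]
  · have hxi : x ≠ i := fun e => hx (e ▸ hiS)
    have hxj : x ≠ j := fun e => hx (e ▸ hjS)
    simp [update, pivot, hxi, hxj]
  · have hxi : x ≠ i := fun e => hx (e ▸ hiS)
    have hxj : x ≠ j := fun e => hx (e ▸ hjS)
    exact hα x hxi (by simp [pivot, hxi, hxj, hxB])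

/-- A variable that was fixed at a violated bound does not enter the basis again. Let `a` solve the
tableau and respect the bounds on `S`, and let `x_n` have the value of a bound that `a` violates or
attains. Then `a` shows that `x_n` cannot repair a variable that is blocked on `S`: comparing `a`
with the current assignment on the row of `x_i`, every summand would have the sign that keeps
`a i` on the wrong side of the bound. -/
theorem Blocked.insert {c : Config X} (h : c.WellFormed) {S : Finset X} {i n : X} (hi : i ∈ c.B)
    (hiS : i ∈ S) (hb : c.Blocked S i) {a : X → ℝ} (ha : c.Solves a)
    (hin : ∀ x ∈ S, c.l x ≤ (a x : EReal) ∧ (a x : EReal) ≤ c.u x)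
    (hout : ∀ x ∉ S, x ≠ n → x ∉ c.B → a x = c.α x)
    (hn : (a n ≤ c.α n ∧ (c.α n : EReal) ≤ c.l n) ∨ (c.α n ≤ a n ∧ c.u n ≤ (c.α n : EReal))) :
    c.Blocked (insert n S) i := by
  have hdiff : a i - c.α i = ∑ j, c.T i j * (a j - c.α j) := by
    simp only [mul_sub, Finset.sum_sub_distrib]
    rw [← ha i hi, ← h.solves i hi]
  -- Only the non-basic variables of `S` and `x_n` contribute to the sum.
  have key : ∀ P : ℝ → Prop, P 0 → ∀ j, (j ∈ S → j ∉ c.B → P (c.T i j * (a j - c.α j))) →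
      (j = n → P (c.T i j * (a j - c.α j))) → P (c.T i j * (a j - c.α j)) := by
    intro P h0 j h1 h2
    by_cases hjB : j ∈ c.B
    · simpa [h.eq_zero_of_mem hjB] using h0
    by_cases hjS : j ∈ S
    · exact h1 hjS hjB
    by_cases hjn : j = n
    · exact h2 hjn
    simpa [hout j hjS hjn hjB] using h0
  have le_of_not_u : ∀ j ∈ S, ¬ (c.α j : EReal) < c.u j → a j - c.α j ≤ 0 := fun j hj h' =>
    sub_nonpos.2 (EReal.coe_le_coe_iff.1 ((hin j hj).2.trans (not_lt.1 h')))
  have le_of_not_l : ∀ j ∈ S, ¬ c.l j < (c.α j : EReal) → 0 ≤ a j - c.α j := fun j hj h' =>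
    sub_nonneg.2 (EReal.coe_le_coe_iff.1 ((not_lt.1 h').trans (hin j hj).1))
  rcases hb with ⟨hB, hS⟩ | ⟨hB, hS⟩
  · refine .inl ⟨hB, fun j hj hjs => ?_⟩
    obtain rfl : j = n := (Finset.mem_insert.1 hj).resolve_right fun hj => hS j hj hjs
    have hle : a i - c.α i ≤ 0 := by
      rw [hdiff]
      refine Finset.sum_nonpos fun k _ => key (· ≤ 0) le_rfl k (fun hk hkB => ?_) ?_
      · have hns := hS k hk
        simp only [slackPos, Set.mem_ofPred_eq, not_and, not_or] at hns
        obtain ⟨h1, h2⟩ := hns hkB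
        rcases lt_trichotomy (c.T i k) 0 with hT | hT | hT
        · exact mul_nonpos_of_nonpos_of_nonneg hT.le (le_of_not_l k hk (h2 hT))
        · simp [hT]
        · exact mul_nonpos_of_nonneg_of_nonpos hT.le (le_of_not_u k hk (h1 hT))
      · rintro rfl
        rcases hn with ⟨h1, h2⟩ | ⟨h1, h2⟩ <;> rcases hjs.2 with ⟨h3, h4⟩ | ⟨h3, h4⟩
        · exact mul_nonpos_of_nonneg_of_nonpos h3.le (sub_nonpos.2 h1)
        · exact absurd h4 h2.not_gt
        · exact absurd h4 h2.not_gt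
        · exact mul_nonpos_of_nonpos_of_nonneg h3.le (sub_nonneg.2 h1)
    exact absurd (hB.trans_le (hin i hiS).1) (by simpa using hle)
  · refine .inr ⟨hB, fun j hj hjs => ?_⟩
    obtain rfl : j = n := (Finset.mem_insert.1 hj).resolve_right fun hj => hS j hj hjs
    have hle : 0 ≤ a i - c.α i := by
      rw [hdiff]
      refine Finset.sum_nonneg fun k _ => key (0 ≤ ·) le_rfl k (fun hk hkB => ?_) ?_
      · have hns := hS k hk
        simp only [slackNeg, Set.mem_ofPred_eq, not_and, not_or] at hns
        obtain ⟨h1, h2⟩ := hns hkB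
        rcases lt_trichotomy (c.T i k) 0 with hT | hT | hT
        · exact mul_nonneg_of_nonpos_of_nonpos hT.le (le_of_not_u k hk (h1 hT))
        · simp [hT]
        · exact mul_nonneg hT.le (le_of_not_l k hk (h2 hT))
      · rintro rfl
        rcases hn with ⟨h1, h2⟩ | ⟨h1, h2⟩ <;> rcases hjs.2 with ⟨h3, h4⟩ | ⟨h3, h4⟩
        · exact mul_nonneg_of_nonpos_of_nonpos h3.le (sub_nonpos.2 h1)
        · exact absurd h4 h2.not_gt
        · exact absurd h4 h2.not_gt
        · exact mul_nonneg h3.le (sub_nonneg.2 h1)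
    exact absurd ((hin i hiS).2.trans_lt hB) (by simpa using hle)

/-- From every ready configuration, simplex moves within `S` lead to a settled one. -/
def Solvable (S : Finset X) : Prop :=
  ∀ c : Config X, c.Ready → ∃ c' : Config X, c'.Ready ∧ Reach S c c' ∧ c'.Settled S

/-- `x_n` has left the basis towards a bound violated by the earlier assignment `a`. -/
theorem Solvable.of_fixed {S : Finset X} (hS : Solvable S) {n : X} (hnS : n ∉ S) {c : Config X}
    (hc : c.Ready) (hnB : n ∉ c.B) {a : X → ℝ} (ha : c.Solves a)
    (hin : ∀ x ∈ S, c.l x ≤ (a x : EReal) ∧ (a x : EReal) ≤ c.u x)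
    (hout : ∀ x ∉ S, x ≠ n → x ∉ c.B → a x = c.α x)
    (hn : (a n ≤ c.α n ∧ (c.α n : EReal) ≤ c.l n) ∨ (c.α n ≤ a n ∧ c.u n ≤ (c.α n : EReal))) :
    ∃ c' : Config X, c'.Ready ∧ Reach (insert n S) c c' ∧ c'.Settled (insert n S) := by
  obtain ⟨c', hc', hr, hs⟩ := hS c hc
  have hnB' : n ∉ c'.B := mt (hr.basic n hnS).1 hnB
  refine ⟨c', hc', hr.mono (Finset.subset_insert _ _), ?_⟩
  rcases hs with hs | ⟨i, hiS, hiB, hb⟩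
  · exact .inl fun x hx => (Finset.mem_insert.1 hx).elim (fun e => e ▸ hc'.2 n hnB') (hs x)
  · refine .inr ⟨i, Finset.mem_insert_of_mem hiS, hiB,
      hb.insert hc'.1 hiB hiS (hr.solves a ha) ?_ (fun x hx hxn hxB => ?_) ?_⟩
    · rwa [hr.l_eq, hr.u_eq]
    · have hxB' := mt (hr.basic x hx).2 hxB
      rw [hr.frozen x hx hxB', hout x hx hxn hxB']
    · rwa [hr.l_eq, hr.u_eq, hr.frozen n hnS hnB]

/-- If `x_n` is basic, then it leaves the basis at most once. -/
theorem Solvable.of_mem {S : Finset X} (hS : Solvable S) {n : X} (hnS : n ∉ S) {c : Config X}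
    (hc : c.Ready) (hnB : n ∈ c.B) :
    ∃ c' : Config X, c'.Ready ∧ Reach (insert n S) c c' ∧ c'.Settled (insert n S) := by
  obtain ⟨c₁, hc₁, hr₁, hs⟩ := hS c hc
  have hnB₁ : n ∈ c₁.B := (hr₁.basic n hnS).2 hnB
  have hr₁' := hr₁.mono (Finset.subset_insert n S)
  rcases hs with hs | ⟨i, hiS, hiB, hb⟩
  · -- `x_n` leaves the basis for the bound `v`, which `c₁.α n` violates.
    have leave : ∀ j ∈ S, ∀ v : ℝ,
        (c₁.Below n ∧ j ∈ c₁.slackPos n ∧ (v : EReal) = c₁.l n) ∨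
        (c₁.Above n ∧ j ∈ c₁.slackNeg n ∧ (v : EReal) = c₁.u n) →
        ∃ c' : Config X, c'.Ready ∧ Reach (insert n S) c c' ∧ c'.Settled (insert n S) := by
      intro j hj v hv
      obtain ⟨w, hw₁, hw₂⟩ := hc₁.1.bounds n
      obtain ⟨c₂, hc₂, hr₂, hB₂, hα₂⟩ := hc₁.exchange (v := v) hnB₁
        (Finset.mem_insert_self n S) (Finset.mem_insert_of_mem hj)
        (hv.imp (fun h => ⟨h.1, h.2.1⟩) fun h => ⟨h.1, h.2.1⟩)
        (by
          rcases hv with ⟨-, -, e⟩ | ⟨-, -, e⟩ <;> rw [e]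
          exact hw₁.trans hw₂)
        (by
          rcases hv with ⟨-, -, e⟩ | ⟨-, -, e⟩ <;> rw [e]
          exact hw₁.trans hw₂)
      obtain ⟨c₃, hc₃, hr₃, hs₃⟩ := hS.of_fixed hnS hc₂ (by simp [hB₂])
        (hr₂.solves _ hc₁.1.solves)
        (by
          rw [hr₂.l_eq, hr₂.u_eq]
          exact hs)
        (fun x hx hxn hxB => by
          have hx' : x ∉ insert n S := by simp [hx, hxn]
          exact (hr₂.frozen x hx' (mt (hr₂.basic x hx').2 hxB)).symm)
        (by
          rw [hr₂.l_eq, hr₂.u_eq, hα₂]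
          refine hv.imp (fun h => ⟨?_, h.2.2.le⟩) fun h => ⟨?_, h.2.2.ge⟩
          · exact EReal.coe_le_coe_iff.1 (h.2.2 ▸ h.1.le)
          · exact EReal.coe_le_coe_iff.1 (h.2.2 ▸ h.1.le))
      exact ⟨c₃, hc₃, (hr₁'.trans hr₂).trans hr₃, hs₃⟩
    rcases c₁.within_or n with hw | hw | hw
    · exact ⟨c₁, hc₁, hr₁', .inl fun x hx => (Finset.mem_insert.1 hx).elim (fun e => e ▸ hw) (hs x)⟩
    · by_cases hj : ∃ j ∈ S, j ∈ c₁.slackPos n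
      · obtain ⟨j, hjS, hj⟩ := hj
        obtain ⟨v, hv⟩ := hc₁.1.exists_coe_eq_l hw
        exact leave j hjS v (.inl ⟨hw, hj, hv⟩)
      · refine ⟨c₁, hc₁, hr₁', .inr ⟨n, Finset.mem_insert_self n S, hnB₁, .inl ⟨hw, ?_⟩⟩⟩
        intro j hjS hjs
        rcases Finset.mem_insert.1 hjS with rfl | hjS
        exacts [hjs.1 hnB₁, hj ⟨j, hjS, hjs⟩]
    · by_cases hj : ∃ j ∈ S, j ∈ c₁.slackNeg n
      · obtain ⟨j, hjS, hj⟩ := hj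
        obtain ⟨v, hv⟩ := hc₁.1.exists_coe_eq_u hw
        exact leave j hjS v (.inr ⟨hw, hj, hv⟩)
      · refine ⟨c₁, hc₁, hr₁', .inr ⟨n, Finset.mem_insert_self n S, hnB₁, .inr ⟨hw, ?_⟩⟩⟩
        intro j hjS hjs
        rcases Finset.mem_insert.1 hjS with rfl | hjS
        exacts [hjs.1 hnB₁, hj ⟨j, hjS, hjs⟩]
  · refine ⟨c₁, hc₁, hr₁', .inr ⟨i, Finset.mem_insert_of_mem hiS, hiB, hb.imp ?_ ?_⟩⟩ <;>
    · rintro ⟨hv, hb⟩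
      refine ⟨hv, fun j hj hjs => ?_⟩
      rcases Finset.mem_insert.1 hj with rfl | hj
      exacts [hjs.1 hnB₁, hb j hj hjs]

/-- If `x_n` is non-basic, then it enters the basis at most once before `Solvable.of_mem` applies. -/
theorem Solvable.insert {S : Finset X} (hS : Solvable S) {n : X} (hnS : n ∉ S) :
    Solvable (insert n S) := by
  intro c hc
  by_cases hnB : n ∈ c.B
  · exact hS.of_mem hnS hc hnB
  obtain ⟨c₁, hc₁, hr₁, hs⟩ := hS c hc
  have hnB₁ : n ∉ c₁.B := mt (hr₁.basic n hnS).1 hnB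
  have hr₁' := hr₁.mono (Finset.subset_insert n S)
  rcases hs with hs | ⟨i, hiS, hiB, hb⟩
  · exact ⟨c₁, hc₁, hr₁',
      .inl fun x hx => (Finset.mem_insert.1 hx).elim (fun e => e ▸ hc₁.2 n hnB₁) (hs x)⟩
  have hiS' : i ∈ Insert.insert n S := Finset.mem_insert_of_mem hiS
  by_cases hn : (c₁.Below i ∧ n ∈ c₁.slackPos i) ∨ (c₁.Above i ∧ n ∈ c₁.slackNeg i)
  · obtain ⟨v, hl, hu⟩ := hc₁.1.bounds i
    obtain ⟨c₂, hc₂, hr₂, hB₂, -⟩ := hc₁.exchange hiB hiS' (Finset.mem_insert_self n S) hn hl hu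
    have hni : n ≠ i := fun e => hnS (e ▸ hiS)
    obtain ⟨c₃, hc₃, hr₃, hs₃⟩ := hS.of_mem hnS hc₂ (by simp [hB₂, hni])
    exact ⟨c₃, hc₃, (hr₁'.trans hr₂).trans hr₃, hs₃⟩
  · refine ⟨c₁, hc₁, hr₁', .inr ⟨i, hiS', hiB, hb.imp ?_ ?_⟩⟩ <;>
    · rintro ⟨hv, hb⟩
      refine ⟨hv, fun j hj hjs => ?_⟩
      rcases Finset.mem_insert.1 hj with rfl | hj
      exacts [hn (by simp [hv, hjs]), hb j hj hjs]

theorem solvable (S : Finset X) : Solvable S := by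
  induction S using Finset.induction_on with
  | empty => exact fun c hc => ⟨c, hc, .refl _ _, .inl fun x hx => absurd hx (Finset.notMem_empty x)⟩
  | insert n S hn ih => exact ih.insert hn

theorem WellFormed.exists_ready {c : Config X} (h : c.WellFormed) :
    ∃ c' : Config X, Relation.ReflTransGen Next c c' ∧ c'.Ready := by
  suffices H : ∀ S : Finset X, ∃ c' : Config X, Relation.ReflTransGen Next c c' ∧
      c'.WellFormed ∧ ∀ x ∈ S, x ∉ c'.B → c'.Within x by
    obtain ⟨c', hp, hc', hS⟩ := H Finset.univ
    exact ⟨c', hp, hc', fun x => hS x (Finset.mem_univ x)⟩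
  intro S
  induction S using Finset.induction_on with
  | empty => exact ⟨c, .refl, h, fun x hx => absurd hx (Finset.notMem_empty x)⟩
  | insert n S hn ih =>
    obtain ⟨c', hp, hc', hS⟩ := ih
    by_cases hnB : n ∈ c'.B
    · exact ⟨c', hp, hc', fun x hx hxB => hS x
        ((Finset.mem_insert.1 hx).resolve_left fun e => hxB (e ▸ hnB)) hxB⟩
    rcases c'.within_or n with hw | hw
    · exact ⟨c', hp, hc', fun x hx hxB => (Finset.mem_insert.1 hx).elim (fun e => e ▸ hw)
        fun hx => hS x hx hxB⟩
    obtain ⟨v, hl, hu⟩ := hc'.bounds n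
    have hv : c'.α n + (v - c'.α n) = v := by ring
    refine ⟨c'.update n (v - c'.α n), hp.tail (.update c' n _ hnB hw ?_ ?_), hc'.update hnB _,
      fun x hx hxB => ?_⟩
    · rwa [hv]
    · rwa [hv]
    · have hxB' : x ∉ c'.B := hxB
      by_cases hxn : x = n
      · subst hxn
        simp [Within, Config.update, hl, hu]
      · have := hS x ((Finset.mem_insert.1 hx).resolve_left hxn) hxB'
        simpa [Within, Config.update, hxn, hxB'] using this

/-- All variables are within their bounds, or `Failure` applies. -/
def Decided (c : Config X) : Prop := c.InBounds ∨ SimplexRule c .unsat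

theorem WellFormed.exists_decided {c : Config X} (h : c.WellFormed) :
    ∃ c' : Config X, Relation.ReflTransGen Next c c' ∧ c'.Decided := by
  obtain ⟨c₁, hp, hc₁⟩ := h.exists_ready
  obtain ⟨c₂, -, hr, hs⟩ := solvable Finset.univ c₁ hc₁
  refine ⟨c₂, hp.trans hr.path, ?_⟩
  rcases hs with hs | ⟨i, -, hi, hb⟩
  · exact .inl fun x => hs x (Finset.mem_univ x)
  · refine .inr (.failure c₂ i hi (hb.imp ?_ ?_)) <;>
    exact fun h => ⟨h.1, Set.eq_empty_of_forall_notMem fun j => h.2 j (Finset.mem_univ j)⟩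

/-- A decided configuration can be reached in exactly `n` simplex moves. -/
def DecidedIn : ℕ → Config X → Prop
  | 0, c => c.Decided
  | n + 1, c => ∃ c', Next c c' ∧ DecidedIn n c'

theorem WellFormed.exists_decidedIn {c : Config X} (h : c.WellFormed) : ∃ n, DecidedIn n c := by
  obtain ⟨c', hp, hd⟩ := h.exists_decided
  induction hp using Relation.ReflTransGen.head_induction_on with
  | refl => exact ⟨0, hd⟩
  | head hstep _ ih =>
    obtain ⟨n, hn⟩ := ih (h.simplexRule hstep)
    exact ⟨n + 1, _, hstep, hn⟩

/-- The least number of simplex moves that lead to a decided configuration (`0` if there are no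
such moves, which does not happen for well-formed configurations). -/
noncomputable def dist (c : Config X) : ℕ := sInf {n | DecidedIn n c}

end Config

theorem SimplexStrategy.IsRun.wellFormed {X : Type*} [Fintype X] [DecidableEq X]
    {σ : SimplexStrategy X} {f : ℕ → Config X} {n : ℕ} (h : σ.IsRun f n) :
    ∀ m ≤ n, (f m).WellFormed
  | 0, _ => h.1
  | m + 1, hm => (h.wellFormed m (by omega)).simplexRule (σ.isRule _ _ _ (h.2 m (by omega)))

/-- The strategy that permits `Failure`, and all moves that bring a decided configuration closer. -/
noncomputable def descent (X : Type*) [Fintype X] [DecidableEq X] : SimplexStrategy X where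
  next _ c s := SimplexRule c s ∧ ∀ c', s = .run c' → c'.dist < c.dist
  isRule _ _ _ h := h.1

theorem descent_terminating (X : Type*) [Fintype X] [DecidableEq X] :
    (descent X).Terminating where
  progress f n hf hin := by
    have hd : DecidedIn (f n).dist (f n) :=
      Nat.sInf_mem (s := {m | DecidedIn m (f n)}) (hf.wellFormed n le_rfl).exists_decidedIn
    cases hk : (f n).dist with
    | zero =>
      rw [hk] at hd
      exact ⟨.unsat, hd.resolve_left hin, fun _ h => by cases h⟩
    | succ k =>
      rw [hk] at hd
      obtain ⟨c', hs, hd'⟩ := hd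
      refine ⟨.run c', hs, fun c'' e => ?_⟩
      cases e
      exact hk ▸ Nat.lt_succ_of_le (Nat.sInf_le hd')
  finite := by
    rintro ⟨f, hf⟩
    exact not_strictAnti_of_wellFoundedLT (fun n => (f n).dist)
      (strictAnti_nat_of_succ_lt fun n => ((hf (n + 1)).2 n n.lt_succ_self).2 _ rfl)

/-! ### Termination of derivations -/

section Termination

variable {X : Type*} [DecidableEq X]

theorem not_acc_of_chain {A : Type*} {r : A → A → Prop} {f : ℕ → A} (hf : ∀ n, r (f (n + 1)) (f n)) :
    ¬ Acc r (f 0) := fun h => not_acc_iff_exists_descending_chain.2 ⟨f, rfl, hf⟩ h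

/-- A simplex move made by `σ`, with the history recorded. -/
def SimplexStrategy.Succ (σ : SimplexStrategy X) (q' q : List (Config X) × Config X) : Prop :=
  σ.next q.1 q.2 (.run q'.2) ∧ q'.1 = q.1 ++ [q.2]

theorem SimplexStrategy.Terminating.acc_succ [Fintype X] {σ : SimplexStrategy X} (hσ : σ.Terminating)
    {c : Config X} (hc : c.WellFormed) : Acc σ.Succ ([], c) := by
  by_contra h
  obtain ⟨g, hg0, hg⟩ := not_acc_iff_exists_descending_chain.1 h
  have hist : ∀ n, (g n).1 = (List.range n).map fun m => (g m).2 := by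
    intro n
    induction n with
    | zero => simp [hg0]
    | succ n ih => simp [(hg n).2, ih, List.range_succ]
  refine hσ.finite ⟨fun n => (g n).2, fun n => ⟨by simpa [hg0] using hc, fun m _ => ?_⟩⟩
  rw [← hist]
  exact (hg m).1

/-- `s'` is a child of `s` that results from a rule allowed by the strategy. -/
def Child (σ : SimplexStrategy X) (K : ℕ) (s' s : Node X) : Prop :=
  Step σ K s s' ∨ ∃ s'', Split K s s' s'' ∨ Split K s s'' s'

open Classical in
/-- The number of ReLU pairs to which the guard of `ReluSplit` applies. -/
noncomputable def Config.splits (c : Config X) : ℕ :=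
  {p ∈ c.R | c.l p.1 < 0 ∧ 0 < c.u p.1}.card

/-- The number of applications of the ReLU rules that the counters still permit. -/
def fuel (K : ℕ) (R : Finset (X × X)) (count : X × X → ℕ) : ℕ := ∑ p ∈ R, (K + 1 - count p)

theorem fuel_lt {K : ℕ} {R : Finset (X × X)} {count : X × X → ℕ} {p : X × X} (hp : p ∈ R)
    (hK : count p ≤ K) : fuel K R (Function.update count p (count p + 1)) < fuel K R count := by
  refine Finset.sum_lt_sum (fun q _ => ?_) ⟨p, hp, by simp; omega⟩
  by_cases hq : q = p
  · subst hq
    simp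
    omega
  · simp [hq]

theorem SplitRule.splits_lt {c c₁ c₂ : Config X} {p : X × X} (h : SplitRule p c c₁ c₂) :
    c₁.splits < c.splits ∧ c₂.splits < c.splits := by
  cases h with
  | split hp hl hu =>
    constructor <;>
    · refine Finset.card_lt_card ((Finset.ssubset_iff_of_subset fun q hq => ?_).2 ⟨p, ?_, ?_⟩)
      · simp only [Finset.mem_filter] at hq ⊢
        refine ⟨hq.1, ?_⟩
        by_cases hqp : q.1 = p.1
        · rw [hqp]
          exact ⟨hl, hu⟩
        · simpa [hqp] using hq.2
      · simp [hp, hl, hu]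
      · simp

theorem acc_of_sat_or_unsat {σ : SimplexStrategy X} {K : ℕ} {s : Node X}
    (h : s = .sat ∨ s = .unsat) : Acc (Child σ K) s := by
  refine ⟨_, fun s' hs' => ?_⟩
  rcases h with rfl | rfl <;> rcases hs' with h | ⟨_, h | h⟩ <;> cases h

/-- Every ReLU rule consumes fuel, every split lowers the number of pairs that can be split, and
between two of these rules only finitely many simplex moves are made. -/
theorem SimplexStrategy.Terminating.acc_child [Fintype X] {σ : SimplexStrategy X}
    (hσ : σ.Terminating) (K : ℕ) :
    ∀ (m k : ℕ) (c : Config X) (count : X × X → ℕ), c.WellFormed → c.splits = m →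
      fuel K c.R count = k → Acc (Child σ K) (.run c count []) := by
  intro m
  induction m using Nat.strong_induction_on with
  | _ m ihm =>
  intro k
  induction k using Nat.strong_induction_on with
  | _ k ihk =>
  intro c count hc hm hk
  suffices H : ∀ q, Acc σ.Succ q → q.2.WellFormed → q.2.splits = m → fuel K q.2.R count = k →
      Acc (Child σ K) (.run q.2 count q.1) from H ([], c) (hσ.acc_succ hc) hc hm hk
  intro q hq
  induction hq with
  | intro q _ ih =>
  intro hc hm hk
  refine ⟨_, fun s hs => ?_⟩
  obtain ⟨hist, c⟩ := q
  dsimp only at hc hm hk hs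
  rcases hs with hs | ⟨s', hs⟩
  · cases hs with
    | simplex _ c' _ _ h =>
      have hr := σ.isRule _ _ _ h
      obtain ⟨hl, hu, hR⟩ := hr.frame
      exact ih (hist ++ [c], c') ⟨h, rfl⟩ (hc.simplexRule hr)
        (by simpa only [Config.splits, hl, hu, hR] using hm) (by rw [hR]; exact hk)
    | failure => exact acc_of_sat_or_unsat (.inr rfl)
    | success => exact acc_of_sat_or_unsat (.inl rfl)
    | relu _ c' _ _ p _ _ hK hr =>
      obtain ⟨hl, hu, hR⟩ := hr.frame
      have hp : p ∈ c.R := by cases hr <;> assumption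
      refine ihk _ ?_ c' _ (hc.reluRule hr)
        (by simpa only [Config.splits, hl, hu, hR] using hm) rfl
      rw [hR, ← hk]
      exact fuel_lt hp hK
  · rcases hs with hs | hs <;> cases hs with
    | split _ _ _ _ _ _ p _ hr _ =>
      -- the node is the first or the second child of the split
      first
      | exact ihm _ (hm ▸ hr.splits_lt.1) _ _ _ (hc.splitRule hr).1 rfl rfl
      | exact ihm _ (hm ▸ hr.splits_lt.2) _ _ _ (hc.splitRule hr).2 rfl rfl

/-- `D'` extends `D` by one rule application. -/
abbrev Extends (σ : SimplexStrategy X) (K : ℕ) (D' D : Tree X) : Prop := Derives σ K D D'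

theorem acc_one {σ : SimplexStrategy X} {K : ℕ} (s : Node X) {t : Tree X}
    (h : Acc (Extends σ K) t) : Acc (Extends σ K) (.one s t) := by
  induction h with
  | intro t _ ih =>
    refine ⟨_, fun D hD => ?_⟩
    cases hD with
    | one _ _ t' h => exact ih t' h

theorem acc_two {σ : SimplexStrategy X} {K : ℕ} (s : Node X) {t₁ t₂ : Tree X}
    (h₁ : Acc (Extends σ K) t₁) (h₂ : Acc (Extends σ K) t₂) :
    Acc (Extends σ K) (.two s t₁ t₂) := by
  induction h₁ generalizing t₂ with
  | intro t₁ _ ih₁ =>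
    induction h₂ with
    | intro t₂ h₂ ih₂ =>
      refine ⟨_, fun D hD => ?_⟩
      cases hD with
      | left _ _ t' _ h => exact ih₁ t' h ⟨_, h₂⟩
      | right _ _ _ t' h => exact ih₂ t' h

theorem acc_leaf {σ : SimplexStrategy X} {K : ℕ} {s : Node X} (h : Acc (Child σ K) s) :
    Acc (Extends σ K) (.leaf s) := by
  induction h with
  | intro s _ ih =>
    refine ⟨_, fun D hD => ?_⟩
    cases hD with
    | step _ s' h => exact acc_one s (ih s' (.inl h))
    | split _ s₁ s₂ h => exact acc_two s (ih s₁ (.inr ⟨s₂, .inl h⟩)) (ih s₂ (.inr ⟨s₁, .inr h⟩))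

end Termination

/-! ### Leaves of trees that cannot be extended -/

/-- If a leaf can be extended, then so can the tree. -/
theorem Tree.exists_derives {X : Type*} [DecidableEq X] {σ : SimplexStrategy X}
    {K : ℕ} {s : Node X}
    (h : ∃ D', Derives σ K (.leaf s) D') :
    ∀ {D : Tree X}, s ∈ D.leaves → ∃ D', Derives σ K D D'
  | .leaf _, hs => by
    obtain rfl := hs
    exact h
  | .one _ t, hs => by
    obtain ⟨t', h'⟩ := exists_derives h (D := t) hs
    exact ⟨_, .one _ _ _ h'⟩
  | .two _ t₁ t₂, hs => by
    rcases hs with hs | hs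
    · obtain ⟨t', h'⟩ := exists_derives h (D := t₁) hs
      exact ⟨_, .left _ _ _ _ h'⟩
    · obtain ⟨t', h'⟩ := exists_derives h (D := t₂) hs
      exact ⟨_, .right _ _ _ _ h'⟩

section Halting

variable {X : Type*} [Fintype X] [DecidableEq X]

/-- The history of a node is that of a run of `σ` which ends in its configuration. -/
def Node.Legal (σ : SimplexStrategy X) : Node X → Prop
  | .sat => True
  | .unsat => True
  | .run c _ hist => ∃ f n, σ.IsRun f n ∧ hist = (List.range n).map f ∧ f n = c

theorem Config.WellFormed.legal {c : Config X} (h : c.WellFormed) (σ : SimplexStrategy X)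
    (count : X × X → ℕ) : (Node.run c count []).Legal σ :=
  ⟨fun _ => c, 0, ⟨h, fun m hm => absurd hm m.not_lt_zero⟩, rfl, rfl⟩

theorem Node.Legal.wellFormed {σ : SimplexStrategy X} {c : Config X} {count : X × X → ℕ}
    {hist : List (Config X)} (h : (Node.run c count hist).Legal σ) : c.WellFormed := by
  obtain ⟨f, n, hf, -, rfl⟩ := h
  exact hf.wellFormed n le_rfl

theorem Node.Legal.step {σ : SimplexStrategy X} {K : ℕ} {s s' : Node X} (h : s.Legal σ)
    (hs : Step σ K s s') : s'.Legal σ := by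
  cases hs with
  | simplex c c' count hist hn =>
    obtain ⟨f, n, hf, rfl, rfl⟩ := h
    have hm : ∀ m ≤ n, Function.update f (n + 1) c' m = f m := fun m hm =>
      Function.update_of_ne (by omega) _ _
    have hmap : ∀ m ≤ n + 1, (List.range m).map (Function.update f (n + 1) c') =
        (List.range m).map f := fun m hm' =>
      List.map_congr_left fun k hk => hm k (by have := List.mem_range.1 hk; omega)
    refine ⟨Function.update f (n + 1) c', n + 1, ⟨?_, fun m hmn => ?_⟩, ?_, by simp⟩
    · rw [hm 0 n.zero_le]
      exact hf.1
    · rw [hmap m hmn.le, hm m (by omega)]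
      rcases Nat.lt_succ_iff_lt_or_eq.1 hmn with hlt | rfl
      · rw [hm (m + 1) hlt]
        exact hf.2 m hlt
      · simpa using hn
    · rw [hmap _ le_rfl, List.range_succ]
      simp
  | failure => trivial
  | success => trivial
  | relu c c' count hist p _ _ _ hr => exact (h.wellFormed.reluRule hr).legal σ _

theorem Node.Legal.split {σ : SimplexStrategy X} {K : ℕ} {s s₁ s₂ : Node X} (h : s.Legal σ)
    (hs : Split K s s₁ s₂) : s₁.Legal σ ∧ s₂.Legal σ := by
  cases hs with
  | split _ _ _ _ _ _ p _ hr _ =>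
    have := h.wellFormed.splitRule hr
    exact ⟨this.1.legal σ _, this.2.legal σ _⟩

theorem Derives.legal {σ : SimplexStrategy X} {K : ℕ} {D D' : Tree X} (h : Derives σ K D D')
    (hD : ∀ s ∈ D.leaves, s.Legal σ) : ∀ s ∈ D'.leaves, s.Legal σ := by
  induction h with
  | step s s' h =>
    rintro _ rfl
    exact (hD s rfl).step h
  | split s s₁ s₂ h =>
    have := (hD s rfl).split h
    rintro _ (rfl | rfl)
    exacts [this.1, this.2]
  | one s t t' _ ih => exact ih hD
  | left s t₁ t₁' t₂ _ ih =>
    rintro r (hr | hr)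
    exacts [ih (fun r hr => hD r (.inl hr)) r hr, hD r (.inr hr)]
  | right s t₁ t₂ t₂' _ ih =>
    rintro r (hr | hr)
    exacts [hD r (.inl hr), ih (fun r hr => hD r (.inr hr)) r hr]

theorem Config.WellFormed.exists_T_ne_zero {c : Config X} (h : c.WellFormed) {i : X} (hi : i ∈ c.B)
    (hα : c.α i ≠ 0) : ∃ j ∉ c.B, c.T i j ≠ 0 := by
  rw [h.satisfies i hi] at hα
  obtain ⟨j, hj, hT⟩ := Finset.exists_ne_zero_of_sum_ne_zero hα
  exact ⟨j, by simpa using hj, left_ne_zero_of_mul hT⟩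

/-- A ReLU rule applies to every broken pair. Where neither update rule does, one of the two
variables is basic with a nonzero value, so its row has a nonzero entry to pivot on. -/
theorem Config.WellFormed.exists_reluRule {c : Config X} (h : c.WellFormed) {p : X × X}
    (hp : p ∈ c.R) (hb : c.Broken p) : ∃ c', ReluRule p c c' := by
  by_cases h2 : p.2 ∈ c.B
  · by_cases hα : c.α p.2 = 0
    · by_cases h1 : p.1 ∈ c.B
      · have hα₁ : c.α p.1 ≠ 0 := fun e => hb (by simp [e, hα])
        obtain ⟨j, hj, hT⟩ := h.exists_T_ne_zero h1 hα₁
        exact ⟨_, .pivotForRelu c p.1 j hp (.inl rfl) h1 hj hT⟩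
      · exact ⟨_, .updateB c hp h1 hb hα.ge⟩
    · obtain ⟨j, hj, hT⟩ := h.exists_T_ne_zero h2 hα
      exact ⟨_, .pivotForRelu c p.2 j hp (.inr rfl) h2 hj hT⟩
  · exact ⟨_, .updateF c hp h2 hb⟩

theorem Node.Legal.halting {σ : SimplexStrategy X} (hσ : σ.Terminating) {K : ℕ} {s : Node X}
    (h : s.Legal σ) (hstep : ¬ ∃ s', Step σ K s s') (hsplit : ¬ ∃ s₁ s₂, Split K s s₁ s₂) :
    s.Halting K := by
  match s with
  | .sat => trivial
  | .unsat => trivial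
  | .run c count hist =>
    have hc : c.WellFormed := h.wellFormed
    have hin : c.InBounds := by
      by_contra hin
      obtain ⟨f, n, hf, rfl, rfl⟩ := h
      obtain ⟨s', hs'⟩ := hσ.progress f n hf hin
      match s' with
      | .sat => exact nomatch σ.isRule _ _ _ hs'
      | .unsat => exact hstep ⟨_, .failure _ _ _ hs'⟩
      | .run c' => exact hstep ⟨_, .simplex _ _ _ _ hs'⟩
    refine ⟨hin, ?_, fun p hp hb => ?_⟩
    · by_contra hb
      exact hstep ⟨_, .success _ _ _ ⟨hin, fun p hp hbp => hb ⟨p, hp, hbp⟩⟩⟩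
    · have hK : K < count p := by
        by_contra hK
        obtain ⟨c', hr⟩ := hc.exists_reluRule hp hb
        exact hstep ⟨_, .relu _ _ _ _ p hin hb (not_lt.1 hK) hr⟩
      refine ⟨hK, ?_⟩
      by_contra! hlu
      exact hsplit ⟨_, _, .split _ _ _ _ _ _ p hK (.split c hp hlu.1 hlu.2) (.inl rfl)⟩

end Halting

end Reluplex

theorem mainTheorem4 {X : Type*} [Fintype X] [DecidableEq X] :
    (∃ σ : Reluplex.SimplexStrategy X, σ.Terminating) ∧
    ∀ σ : Reluplex.SimplexStrategy X, σ.Terminating →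
      ∀ (K : ℕ) (c : Reluplex.Config X), c.WellFormed →
        (¬ ∃ D : ℕ → Reluplex.Tree X, D 0 = Reluplex.startTree c ∧
          ∀ i, Reluplex.Derives σ K (D i) (D (i + 1))) ∧
        ∀ D : Reluplex.Tree X,
          Relation.ReflTransGen (Reluplex.Derives σ K) (Reluplex.startTree c) D →
          (¬ ∃ D' : Reluplex.Tree X, Reluplex.Derives σ K D D') →
          ∀ s ∈ D.leaves, s.Halting K := by
  refine ⟨⟨_, Reluplex.descent_terminating X⟩, fun σ hσ K c hc => ⟨?_, fun D hD hmax s hs => ?_⟩⟩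
  · rintro ⟨D, hD0, hD⟩
    refine Reluplex.not_acc_of_chain (r := Reluplex.Extends σ K) hD ?_
    rw [hD0]
    exact Reluplex.acc_leaf (hσ.acc_child K _ _ c _ hc rfl rfl)
  · have hlegal : ∀ s ∈ D.leaves, s.Legal σ := by
      clear hmax hs
      induction hD with
      | refl =>
        rintro _ rfl
        exact hc.legal σ _
      | tail _ hstep ih => exact hstep.legal ih
    refine (hlegal s hs).halting hσ ?_ ?_
    · rintro ⟨s', h⟩
      exact hmax (Reluplex.Tree.exists_derives ⟨_, .step _ _ h⟩ hs)
    · rintro ⟨s₁, s₂, h⟩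
      exact hmax (Reluplex.Tree.exists_derives ⟨_, .split _ _ _ h⟩ hs)
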